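/- Let $(M,g)$ be a connected complete Riemannian manifold (smooth, finite-dimensional, without boundary, with smooth metric $g$). Then there exists a sequence of functions $\phi_N:M\to\mathbb{R}$, $N=1,2,\dots$, with the following properties: (a) $\phi_N\in C_c^\infty(M)$, i.e. $\phi_N$ is $C^\infty$ and has compact support, for every $N$; (b) $0\le\phi_N(x)\le 1$ for all $x\in M$ and all $N$; (c) for every compact $K\subset M$ there exists $N_0>0$ such that $\phi_N=1$ on $K$ for all $N\ge N_0$; (d) $\varepsilon_N:=\sup_{x\in M}|\nabla\phi_N(x)|$ is finite for every $N$, and $\varepsilon_N\to 0$ as $N\to\infty$. Here $\nabla\phi_N$ is the gradient with respect to $g$, and $|\cdot|$ is the norm given by $g$ on the tangent spaces. -/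

import Mathlib

open Bundle Manifold Filter Topology
open scoped ContDiff

/-- The Riemannian gradient of a real function `f` at `x`: the tangent vector that represents the
differential of `f` at `x` with respect to the Riemannian inner product of the tangent space. -/
noncomputable def riemannianGradient (n : ℕ) {M : Type*} [TopologicalSpace M]
    [ChartedSpace (EuclideanSpace ℝ (Fin n)) M]
    [RiemannianBundle (fun x : M ↦ TangentSpace (𝓡 n) x)]
    (f : M → ℝ) (x : M) : TangentSpace (𝓡 n) x :=
  haveI : FiniteDimensional ℝ (TangentSpace (𝓡 n) x) :=
    inferInstanceAs (FiniteDimensional ℝ (EuclideanSpace ℝ (Fin n)))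
  haveI : CompleteSpace (TangentSpace (𝓡 n) x) := FiniteDimensional.complete ℝ _
  (InnerProductSpace.toDual ℝ (TangentSpace (𝓡 n) x)).symm (mfderiv (𝓡 n) 𝓘(ℝ, ℝ) f x)

/-- The defining property of the gradient: `⟨∇f(x), v⟩ = df(x) v`. -/
theorem inner_riemannianGradient {n : ℕ} {M : Type*} [TopologicalSpace M]
    [ChartedSpace (EuclideanSpace ℝ (Fin n)) M]
    [RiemannianBundle (fun x : M ↦ TangentSpace (𝓡 n) x)]
    (f : M → ℝ) (x : M) (v : TangentSpace (𝓡 n) x) :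
    inner ℝ (riemannianGradient n f x) v = mfderiv (𝓡 n) 𝓘(ℝ, ℝ) f x v := by
  have : FiniteDimensional ℝ (TangentSpace (𝓡 n) x) :=
    inferInstanceAs (FiniteDimensional ℝ (EuclideanSpace ℝ (Fin n)))
  have : CompleteSpace (TangentSpace (𝓡 n) x) := FiniteDimensional.complete ℝ _
  exact InnerProductSpace.toDual_symm_apply

/-! Truncate the distance to a base point `o`: `max 0 (min 1 (2 - dist x o / (N + 1)))` is `1 / (N +
1)`-Lipschitz, equals 1 on the ball of radius `N + 1` and vanishes beyond `2 * (N + 1)`.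
Completeness makes closed balls compact (Hopf-Rinow), so its support is compact and every compact
set is eventually in the region where it is 1.

It remains to smooth it without losing the Lipschitz bound by more than a fixed factor. In a small
chart the metric is nearly constant, and convolution keeps a Lipschitz bound with respect to a fixed
norm (`exists_contDiff_approx_of_abs_sub_le`). The local pieces are glued by a partition of unity;
since the weights sum to a constant, their derivatives only meet the approximation errors, which can
be made arbitrarily small. A final composition with a smooth step function restores the exact values
0 and 1. -/

/-- The derivative is continuous and vanishes outside `[0, 1]`. -/
theorem Real.smoothTransition.exists_abs_deriv_le :
    ∃ C : ℝ, 0 ≤ C ∧ ∀ t, |deriv Real.smoothTransition t| ≤ C := by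
  have hc : Continuous (deriv Real.smoothTransition) :=
    (Real.smoothTransition.contDiff (n := 1)).continuous_deriv le_rfl
  have hs : HasCompactSupport (deriv Real.smoothTransition) := by
    refine HasCompactSupport.intro (isCompact_Icc (a := (0 : ℝ)) (b := 1)) fun t ht ↦ ?_
    rw [Set.mem_Icc, not_and_or, not_le, not_le] at ht
    rcases ht with ht | ht
    · have : Real.smoothTransition =ᶠ[𝓝 t] fun _ ↦ 0 := by
        filter_upwards [Iio_mem_nhds ht] with s hs
        exact Real.smoothTransition.zero_of_nonpos (le_of_lt hs)
      rw [this.deriv_eq, deriv_const]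
    · have : Real.smoothTransition =ᶠ[𝓝 t] fun _ ↦ 1 := by
        filter_upwards [Ioi_mem_nhds ht] with s hs
        exact Real.smoothTransition.one_of_one_le (le_of_lt hs)
      rw [this.deriv_eq, deriv_const]
  obtain ⟨C, hC⟩ := hs.exists_bound_of_continuous hc
  exact ⟨C, (norm_nonneg _).trans (hC 0), hC⟩

/-! ### Mollification of Lipschitz functions in Euclidean space -/

section Mollification

open MeasureTheory Metric
open scoped Convolution

variable {E : Type*} [NormedAddCommGroup E] [InnerProductSpace ℝ E] [FiniteDimensional ℝ E]

/-- A function on a ball that is Lipschitz with respect to a positively homogeneous function `q`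
is approximated on the concentric half ball by smooth functions whose derivative is bounded
by `q`. -/
theorem exists_contDiff_approx_of_abs_sub_le {h q : E → ℝ} {a : E} {R C ε : ℝ} (hR : 0 < R)
    (hε : 0 < ε) (hC : 0 ≤ C) (hq : ∀ v, q v ≤ C * ‖v‖)
    (hq_smul : ∀ (t : ℝ) v, q (t • v) = |t| * q v) (hq0 : ∀ v, 0 ≤ q v)
    (hh : ∀ x ∈ ball a R, ∀ y ∈ ball a R, |h x - h y| ≤ q (x - y)) :
    ∃ G : E → ℝ, ContDiff ℝ ∞ G ∧
      ∀ x ∈ ball a (R / 2), |G x - h x| ≤ ε ∧ ∀ v, |fderiv ℝ G x v| ≤ q v := by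
  borelize E
  let μ : Measure E := volume
  have hcont : ContinuousOn h (ball a R) := by
    refine (LipschitzOnWith.of_dist_le_mul (K := ⟨C, hC⟩) fun x hx y hy ↦ ?_).continuousOn
    rw [Real.dist_eq, dist_eq_norm]
    exact (hh x hx y hy).trans (hq _)
  -- Extension by zero makes the convolution globally defined; from the half ball, a kernel of
  -- radius at most `R / 2` only sees `h`.
  set k : E → ℝ := (ball a R).indicator h with hk
  have hk_eq : ∀ x ∈ ball a R, k x = h x := fun x hx ↦ Set.indicator_of_mem hx h
  have hk_meas : AEStronglyMeasurable k μ :=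
    (aestronglyMeasurable_indicator_iff measurableSet_ball).2
      (hcont.aestronglyMeasurable measurableSet_ball)
  have hk_int : LocallyIntegrable k μ := by
    have : IntegrableOn h (ball a R) μ := by
      refine IntegrableOn.of_bound measure_ball_lt_top
        (hcont.aestronglyMeasurable measurableSet_ball) (|h a| + C * R) ?_
      refine (ae_restrict_iff' measurableSet_ball).2 (Eventually.of_forall fun x hx ↦ ?_)
      have h1 := (hh x hx a (mem_ball_self hR)).trans (hq _)
      have h2 : ‖x - a‖ ≤ R := (mem_ball_iff_norm.1 hx).le
      have h3 := abs_sub_abs_le_abs_sub (h x) (h a)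
      have h4 := mul_le_mul_of_nonneg_left h2 hC
      rw [Real.norm_eq_abs]
      linarith
    exact (this.integrable_indicator measurableSet_ball).locallyIntegrable
  obtain ⟨δ, hδ, hδR, hδε⟩ : ∃ δ > 0, δ ≤ R / 2 ∧ C * δ ≤ ε := by
    refine ⟨min (R / 2) (ε / (C + 1)), by positivity, min_le_left _ _, ?_⟩
    calc C * min (R / 2) (ε / (C + 1)) ≤ (C + 1) * (ε / (C + 1)) := by
          gcongr
          · linarith
          · exact min_le_right _ _
      _ = ε := by field_simp
  let φ : ContDiffBump (0 : E) := ⟨δ / 2, δ, by positivity, by linarith⟩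
  let G : E → ℝ := φ.normed μ ⋆[ContinuousLinearMap.lsmul ℝ ℝ, μ] k
  have hG : ContDiff ℝ ∞ G :=
    φ.hasCompactSupport_normed.contDiff_convolution_left _ φ.contDiff_normed hk_int
  have hex : ∀ x, Integrable (fun t ↦ φ.normed μ t • k (x - t)) μ := fun x ↦
    φ.hasCompactSupport_normed.convolutionExists_left (ContinuousLinearMap.lsmul ℝ ℝ)
      φ.continuous_normed hk_int x
  have hsub : ∀ x ∈ ball a (R / 2), ∀ t ∈ ball (0 : E) δ, x - t ∈ ball a R := by
    intro x hx t ht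
    rw [mem_ball_iff_norm] at hx ⊢
    rw [mem_ball_zero_iff] at ht
    calc ‖x - t - a‖ = ‖(x - a) - t‖ := by congr 1; abel
      _ ≤ ‖x - a‖ + ‖t‖ := norm_sub_le _ _
      _ < R := by linarith
  -- Translation leaves the displacement `x - y` unchanged, so averaging against a kernel of mass
  -- one keeps the bound with no loss.
  have hlip : ∀ x ∈ ball a (R / 2), ∀ y ∈ ball a (R / 2), |G x - G y| ≤ q (x - y) := by
    intro x hx y hy
    have : G x - G y = ∫ t, φ.normed μ t * (k (x - t) - k (y - t)) ∂μ := by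
      simp only [G, convolution_def, ContinuousLinearMap.lsmul_apply]
      rw [← integral_sub (hex x) (hex y)]
      simp only [smul_eq_mul, mul_sub]
    rw [this, ← Real.norm_eq_abs]
    calc _ ≤ ∫ t, φ.normed μ t * q (x - y) ∂μ := by
          refine norm_integral_le_of_norm_le (φ.integrable_normed.mul_const _)
            (Eventually.of_forall fun t ↦ ?_)
          rw [norm_mul, Real.norm_of_nonneg (φ.nonneg_normed t)]
          by_cases ht : t ∈ ball (0 : E) δ
          · have hxt := hsub x hx t ht
            have hyt := hsub y hy t ht
            rw [hk_eq _ hxt, hk_eq _ hyt, Real.norm_eq_abs]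
            have := hh _ hxt _ hyt
            rw [sub_sub_sub_cancel_right] at this
            exact mul_le_mul_of_nonneg_left this (φ.nonneg_normed t)
          · have : φ.normed μ t = 0 := by
              rw [← Function.notMem_support, φ.support_normed_eq]
              exact ht
            simp [this]
      _ = q (x - y) := by rw [integral_mul_const, φ.integral_normed, one_mul]
  refine ⟨G, hG, fun x hx ↦ ⟨?_, fun v ↦ ?_⟩⟩
  · have hxR : x ∈ ball a R := ball_subset_ball (by linarith) hx
    have := φ.dist_normed_convolution_le (μ := μ) (g := k) (x₀ := x) (ε := ε) hk_meas ?_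
    · rwa [Real.dist_eq, hk_eq x hxR] at this
    · intro y hy
      have hy' : ‖y - x‖ < δ := mem_ball_iff_norm.1 hy
      have hyR : y ∈ ball a R := by
        simpa using hsub x hx (x - y) (by rwa [mem_ball_zero_iff, norm_sub_rev])
      rw [hk_eq x hxR, hk_eq y hyR, Real.dist_eq]
      exact ((hh y hyR x hxR).trans (hq _)).trans
        ((mul_le_mul_of_nonneg_left hy'.le hC).trans hδε)
  -- By homogeneity, the increment of `G` along this line is at most `|t| * q v`.
  · have hline : HasDerivAt (fun t : ℝ ↦ x + t • v) v 0 := by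
      simpa using ((hasDerivAt_id (0 : ℝ)).smul_const v).const_add x
    have hd : HasDerivAt (fun t : ℝ ↦ G (x + t • v)) (fderiv ℝ G x v) 0 := by
      have h1 : HasFDerivAt G (fderiv ℝ G x) (x + (0 : ℝ) • v) := by
        rw [zero_smul, add_zero]
        exact (hG.differentiable (by simp) x).hasFDerivAt
      exact h1.comp_hasDerivAt 0 hline
    have hmem : ∀ᶠ t : ℝ in 𝓝 0, x + t • v ∈ ball a (R / 2) := by
      refine hline.continuousAt.eventually_mem (isOpen_ball.mem_nhds ?_)
      simpa using hx
    refine hd.le_of_lip' (hq0 v) ?_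
    filter_upwards [hmem] with t ht
    have := hlip _ ht x hx
    rw [add_sub_cancel_left, hq_smul] at this
    simpa [mul_comm] using this

end Mollification

/-! ### Compactness of closed balls in length spaces -/

section HopfRinow

open Metric

/-- The Hopf-Rinow theorem for length spaces: if every distance is approximately additive along
some intermediate points, then local compactness and completeness give compact closed balls. -/
theorem properSpace_of_exists_dist_le {X : Type*} [MetricSpace X] [CompleteSpace X]
    [LocallyCompactSpace X]
    (H : ∀ (x y : X) (s ε : ℝ), 0 ≤ s → s ≤ dist x y → 0 < ε →
      ∃ z, dist x z ≤ s ∧ dist z y ≤ dist x y - s + ε) : ProperSpace X := by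
  have mono : ∀ (o : X) {r r' : ℝ}, r' ≤ r → IsCompact (closedBall o r) →
      IsCompact (closedBall o r') := fun o r r' h hc ↦
    hc.of_isClosed_subset isClosed_closedBall (closedBall_subset_closedBall h)
  -- Every point of the ball lies within `2 * ε / 3` of a slightly smaller ball, so a finite `ε /
  -- 3`-net there is an `ε`-net here.
  have left : ∀ (o : X) {r : ℝ}, 0 < r → (∀ r' < r, IsCompact (closedBall o r')) →
      IsCompact (closedBall o r) := by
    intro o r hr hc
    rw [isCompact_iff_totallyBounded_isComplete]
    refine ⟨Metric.totallyBounded_iff.2 fun ε hε ↦ ?_, isClosed_closedBall.isComplete⟩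
    set s := max (r - ε / 3) 0
    have hs : s < r := max_lt (by linarith) hr
    have hrs : r - ε / 3 ≤ s := le_max_left _ _
    obtain ⟨t, ht, hcov⟩ := Metric.totallyBounded_iff.1 (hc s hs).totallyBounded (ε / 3)
      (by positivity)
    refine ⟨t, ht, fun x hx ↦ ?_⟩
    rw [mem_closedBall, dist_comm] at hx
    obtain ⟨z, hz, hzx⟩ : ∃ z, dist o z ≤ s ∧ dist z x < 2 * ε / 3 := by
      rcases le_total (dist o x) s with h | h
      · exact ⟨x, h, by rw [dist_self]; positivity⟩
      · obtain ⟨z, hz, hzx⟩ := H o x s (ε / 4) (le_max_right _ _) h (by positivity)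
        exact ⟨z, hz, by linarith⟩
    have hz' : z ∈ closedBall o s := by rwa [mem_closedBall, dist_comm]
    obtain ⟨y, hy, hzy⟩ := Set.mem_iUnion₂.1 (hcov hz')
    refine Set.mem_iUnion₂.2 ⟨y, hy, ?_⟩
    rw [mem_ball] at hzy ⊢
    have := dist_triangle x z y
    rw [dist_comm x z] at this
    linarith
  -- By local compactness some closed thickening of the ball is compact, and it contains a slightly
  -- larger ball.
  have right : ∀ (o : X) {r : ℝ}, 0 ≤ r → IsCompact (closedBall o r) →
      ∃ δ > 0, IsCompact (closedBall o (r + δ)) := by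
    intro o r hr hc
    obtain ⟨δ, hδ, hcδ⟩ := hc.exists_isCompact_cthickening
    refine ⟨δ / 2, by positivity, hcδ.of_isClosed_subset isClosed_closedBall fun x hx ↦ ?_⟩
    rw [mem_closedBall, dist_comm] at hx
    rcases le_total (dist o x) r with h | h
    · exact self_subset_cthickening _ (by rwa [mem_closedBall, dist_comm])
    · obtain ⟨z, hz, hzx⟩ := H o x r (δ / 2) hr h (by positivity)
      refine mem_cthickening_of_dist_le x z δ _ (by rwa [mem_closedBall, dist_comm]) ?_
      rw [dist_comm]
      linarith
  refine ⟨fun o b ↦ ?_⟩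
  rcases lt_or_ge b 0 with hb | hb
  · simp [closedBall_eq_empty.2 hb]
  -- Continuous induction on `[0, b]`: `left` makes the set of good radii closed, `right` extends it
  -- past each of its points.
  let S : Set ℝ := {r | IsCompact (closedBall o r)}
  have h0 : (0 : ℝ) ∈ S := by simp [S]
  have hclosed : IsClosed (S ∩ Set.Icc 0 b) := by
    refine isClosed_of_closure_subset fun r hr ↦ ?_
    have hrI : r ∈ Set.Icc 0 b :=
      closure_minimal Set.inter_subset_right isClosed_Icc hr
    refine ⟨?_, hrI⟩
    rcases hrI.1.eq_or_lt with h | h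
    · rwa [← h]
    refine left o h fun r' hr' ↦ ?_
    obtain ⟨s, hs, hsS⟩ := mem_closure_iff.1 hr (Set.Ioi r') isOpen_Ioi hr'
    exact mono o (le_of_lt hs) hsS.1
  refine hclosed.Icc_subset_of_forall_exists_gt h0 (fun r hr y hy ↦ ?_) ⟨hb, le_rfl⟩
  obtain ⟨δ, hδ, hc⟩ := right o hr.2.1 hr.1
  refine ⟨min (r + δ) y, mono o (min_le_left _ _) hc, lt_min (by linarith) hy, min_le_right _ _⟩

end HopfRinow

/-! ### Calculus of pointwise bounds on the differential -/

section DerivBound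

variable {n : ℕ} {M : Type*} [TopologicalSpace M] [ChartedSpace (EuclideanSpace ℝ (Fin n)) M]
  [RiemannianBundle (fun x : M ↦ TangentSpace (𝓡 n) x)]

/-- The function `f` is differentiable at `x`, and its differential has norm at most `C`. -/
def MDerivBoundAt (n : ℕ) {M : Type*} [TopologicalSpace M]
    [ChartedSpace (EuclideanSpace ℝ (Fin n)) M]
    [RiemannianBundle (fun x : M ↦ TangentSpace (𝓡 n) x)] (f : M → ℝ) (C : ℝ) (x : M) : Prop :=
  ∃ D : TangentSpace (𝓡 n) x →L[ℝ] ℝ, HasMFDerivAt (𝓡 n) 𝓘(ℝ, ℝ) f x D ∧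
    ∀ v : TangentSpace (𝓡 n) x, |D v| ≤ C * ‖v‖

namespace MDerivBoundAt

variable {f g : M → ℝ} {C C' : ℝ} {x : M}

theorem mono (hf : MDerivBoundAt n f C x) (h : C ≤ C') : MDerivBoundAt n f C' x := by
  obtain ⟨D, hD, hb⟩ := hf
  exact ⟨D, hD, fun v ↦ (hb v).trans (mul_le_mul_of_nonneg_right h (norm_nonneg v))⟩

theorem congr_of_eventuallyEq (hf : MDerivBoundAt n f C x) (h : g =ᶠ[𝓝 x] f) :
    MDerivBoundAt n g C x := by
  obtain ⟨D, hD, hb⟩ := hf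
  exact ⟨D, hD.congr_of_eventuallyEq h, hb⟩

theorem const (c : ℝ) : MDerivBoundAt n (fun _ : M ↦ c) 0 x :=
  ⟨0, hasMFDerivAt_const c x, fun v ↦ by simp⟩

theorem add (hf : MDerivBoundAt n f C x) (hg : MDerivBoundAt n g C' x) :
    MDerivBoundAt n (fun y ↦ f y + g y) (C + C') x := by
  obtain ⟨D, hD, hb⟩ := hf
  obtain ⟨D', hD', hb'⟩ := hg
  refine ⟨D + D', hD.add hD', fun v ↦ ?_⟩
  rw [add_mul]
  exact (abs_add_le (D v) (D' v)).trans (add_le_add (hb v) (hb' v))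

theorem mul (hf : MDerivBoundAt n f C x) (hg : MDerivBoundAt n g C' x) :
    MDerivBoundAt n (fun y ↦ f y * g y) (|f x| * C' + |g x| * C) x := by
  obtain ⟨D, hD, hb⟩ := hf
  obtain ⟨D', hD', hb'⟩ := hg
  refine ⟨f x • D' + g x • D, HasMFDerivAt.mul hD hD', fun v ↦ ?_⟩
  calc |f x * D' v + g x * D v| ≤ |f x| * |D' v| + |g x| * |D v| := by
        rw [← abs_mul, ← abs_mul]
        exact abs_add_le _ _
    _ ≤ |f x| * (C' * ‖v‖) + |g x| * (C * ‖v‖) := by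
        gcongr
        · exact hb' v
        · exact hb v
    _ = _ := by ring

theorem sum {ι : Type*} {t : Finset ι} {f : ι → M → ℝ} {C : ι → ℝ}
    (hf : ∀ i ∈ t, MDerivBoundAt n (f i) (C i) x) :
    MDerivBoundAt n (fun y ↦ ∑ i ∈ t, f i y) (∑ i ∈ t, C i) x := by
  classical
  induction t using Finset.induction_on with
  | empty => simpa using const (0 : ℝ)
  | insert i t hi ih =>
    simp only [Finset.sum_insert hi]
    exact (hf i (Finset.mem_insert_self i t)).add
      (ih fun j hj ↦ hf j (Finset.mem_insert_of_mem hj))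

theorem comp {χ : ℝ → ℝ} {K : ℝ} (hχ : DifferentiableAt ℝ χ (f x)) (hK : |deriv χ (f x)| ≤ K)
    (hf : MDerivBoundAt n f C x) : MDerivBoundAt n (fun y ↦ χ (f y)) (K * C) x := by
  obtain ⟨D, hD, hb⟩ := hf
  refine ⟨(fderiv ℝ χ (f x)).comp D,
    (HasMFDerivAt.comp x (hχ.hasFDerivAt.hasMFDerivAt) hD), fun v ↦ ?_⟩
  have : fderiv ℝ χ (f x) (D v) = D v * deriv χ (f x) := by
    rw [← fderiv_apply_one_eq_deriv, ← smul_eq_mul, ← map_smul, smul_eq_mul, mul_one]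
  rw [ContinuousLinearMap.comp_apply, this, abs_mul, mul_comm, mul_assoc]
  gcongr
  · exact (abs_nonneg _).trans hK
  · exact hb v

/-- Evaluating the differential at the gradient itself gives `‖∇f‖ ^ 2 ≤ C * ‖∇f‖`. -/
theorem norm_riemannianGradient_le (hf : MDerivBoundAt n f C x) (hC : 0 ≤ C) :
    ‖riemannianGradient n f x‖ ≤ C := by
  obtain ⟨D, hD, hb⟩ := hf
  have h1 := inner_riemannianGradient f x (riemannianGradient n f x)
  rw [hD.mfderiv, real_inner_self_eq_norm_sq] at h1
  have h2 := (le_abs_self _).trans (hb (riemannianGradient n f x))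
  have h3 : ‖riemannianGradient n f x‖ ^ 2 ≤ C * ‖riemannianGradient n f x‖ := h1.trans_le h2
  by_contra! h
  nlinarith [norm_nonneg (riemannianGradient n f x)]

end MDerivBoundAt

end DerivBound

/-! ### Comparison of the metric with its value at the chart centre -/

section Chart

variable {n : ℕ} {M : Type*} [TopologicalSpace M] [ChartedSpace (EuclideanSpace ℝ (Fin n)) M]
  [RiemannianBundle (fun x : M ↦ TangentSpace (𝓡 n) x)]
  [IsManifold (𝓡 n) 1 M] [IsContinuousRiemannianBundle (EuclideanSpace ℝ (Fin n))
      (fun x : M ↦ TangentSpace (𝓡 n) x)]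

/-- The Riemannian norm of the tangent space at `p`, read in the preferred chart at `p`. -/
noncomputable def chartNorm (n : ℕ) {M : Type*} [TopologicalSpace M]
    [ChartedSpace (EuclideanSpace ℝ (Fin n)) M]
    [RiemannianBundle (fun x : M ↦ TangentSpace (𝓡 n) x)] [IsManifold (𝓡 n) 1 M]
    (p : M) (v : EuclideanSpace ℝ (Fin n)) : ℝ :=
  ‖(trivializationAt (EuclideanSpace ℝ (Fin n)) (fun x : M ↦ TangentSpace (𝓡 n) x) p).symmL ℝ p v‖

omit [IsContinuousRiemannianBundle (EuclideanSpace ℝ (Fin n))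
      (fun x : M ↦ TangentSpace (𝓡 n) x)] in
theorem chartNorm_smul (p : M) (t : ℝ) (v : EuclideanSpace ℝ (Fin n)) :
    chartNorm n p (t • v) = |t| * chartNorm n p v := by
  rw [chartNorm, map_smul, norm_smul, Real.norm_eq_abs, chartNorm]

omit [IsContinuousRiemannianBundle (EuclideanSpace ℝ (Fin n))
      (fun x : M ↦ TangentSpace (𝓡 n) x)] in
theorem exists_chartNorm_le (p : M) :
    ∃ C, 0 ≤ C ∧ ∀ v : EuclideanSpace ℝ (Fin n), chartNorm n p v ≤ C * ‖v‖ :=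
  ⟨_, norm_nonneg _, fun v ↦ ContinuousLinearMap.le_opNorm _ v⟩

/-- The chart differential is the tangent trivialization, and continuity of the metric keeps the
norms at `y` and `p` within a factor 2. This carries derivative bounds from the chart back to `M`.
-/
theorem eventually_chartNorm_mfderiv_le (p : M) :
    ∀ᶠ y in 𝓝 p, ∀ w : TangentSpace (𝓡 n) y,
      chartNorm n p (mfderiv (𝓡 n) 𝓘(ℝ, EuclideanSpace ℝ (Fin n)) (extChartAt (𝓡 n) p) y w)
        ≤ 2 * ‖w‖ := by
  filter_upwards [eventually_norm_symmL_trivializationAt_self_comp_lt (EuclideanSpace ℝ (Fin n))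
    (fun x : M ↦ TangentSpace (𝓡 n) x) p (r := 2) one_lt_two, chart_source_mem_nhds (EuclideanSpace ℝ (Fin n)) p] with y hy hys w
  rw [← TangentBundle.continuousLinearMapAt_trivializationAt hys]
  exact (ContinuousLinearMap.le_of_opNorm_le _ hy.le w)

/-- The reverse comparison, used to bound lengths of curves drawn in the chart. -/
theorem eventually_norm_mfderivWithin_symm_le (p : M) :
    ∀ᶠ z in 𝓝 (extChartAt (𝓡 n) p p), ∀ v : EuclideanSpace ℝ (Fin n),
      ‖mfderivWithin 𝓘(ℝ, EuclideanSpace ℝ (Fin n)) (𝓡 n) (extChartAt (𝓡 n) p).symm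
        (Set.range (𝓡 n)) z v‖ ≤ 2 * chartNorm n p v := by
  set T := trivializationAt (EuclideanSpace ℝ (Fin n)) (fun x : M ↦ TangentSpace (𝓡 n) x) p
  have key : ∀ᶠ y in 𝓝 p, y ∈ (chartAt (EuclideanSpace ℝ (Fin n)) p).source ∧
      ∀ v : EuclideanSpace ℝ (Fin n), ‖T.symmL ℝ y v‖ ≤ 2 * chartNorm n p v := by
    filter_upwards [eventually_norm_symmL_trivializationAt_comp_self_lt
      (EuclideanSpace ℝ (Fin n)) (fun x : M ↦ TangentSpace (𝓡 n) x) p (r := 2) one_lt_two,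
      chart_source_mem_nhds (EuclideanSpace ℝ (Fin n)) p] with y hy hys
    refine ⟨hys, fun v ↦ ?_⟩
    have h := ContinuousLinearMap.le_of_opNorm_le _ hy.le (T.symmL ℝ p v)
    rwa [ContinuousLinearMap.comp_apply,
      T.continuousLinearMapAt_symmL (FiberBundle.mem_baseSet_trivializationAt' p)] at h
  have hc : Tendsto (extChartAt (𝓡 n) p).symm (𝓝 (extChartAt (𝓡 n) p p)) (𝓝 p) := by
    have h := continuousAt_extChartAt_symm (I := 𝓡 n) p
    rwa [ContinuousAt, extChartAt_to_inv] at h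
  filter_upwards [hc.eventually key, extChartAt_target_mem_nhds (I := 𝓡 n) p] with z hz hzt v
  have h := TangentBundle.symmL_trivializationAt (I := 𝓡 n) (𝕜 := ℝ) hz.1
  rw [(extChartAt (𝓡 n) p).right_inv hzt] at h
  rw [← h]
  exact hz.2 v

end Chart

/-! ### Smoothing near a point, and local derivative bounds -/

section LocalSmoothing

open MeasureTheory Metric

variable {n : ℕ} {M : Type*} [MetricSpace M] [ChartedSpace (EuclideanSpace ℝ (Fin n)) M]
  [RiemannianBundle (fun x : M ↦ TangentSpace (𝓡 n) x)]
  [IsManifold (𝓡 n) 1 M] [IsContinuousRiemannianBundle (EuclideanSpace ℝ (Fin n))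
      (fun x : M ↦ TangentSpace (𝓡 n) x)]

/-- Near any point, the inverse of the preferred chart is 2-Lipschitz for the Riemannian norm at
that point. -/
theorem exists_dist_extChartAt_symm_le [IsRiemannianManifold (𝓡 n) M] (p : M) :
    ∃ R > 0, ball (extChartAt (𝓡 n) p p) R ⊆ (extChartAt (𝓡 n) p).target ∧
      ∀ a ∈ ball (extChartAt (𝓡 n) p p) R, ∀ b ∈ ball (extChartAt (𝓡 n) p p) R,
        dist ((extChartAt (𝓡 n) p).symm a) ((extChartAt (𝓡 n) p).symm b)
          ≤ 2 * chartNorm n p (a - b) := by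
  obtain ⟨R, hR, hsub⟩ := Metric.mem_nhds_iff.1 (inter_mem
    (extChartAt_target_mem_nhds (I := 𝓡 n) p) (eventually_norm_mfderivWithin_symm_le p))
  refine ⟨R, hR, fun z hz ↦ (hsub hz).1, fun a ha b hb ↦ ?_⟩
  rw [dist_comm]
  set e := extChartAt (𝓡 n) p
  -- The distance is at most the length of the image of this segment, which stays in the convex ball
  -- and has constant velocity `a - b`.
  let η : ℝ →ᴬ[ℝ] EuclideanSpace ℝ (Fin n) := ContinuousAffineMap.lineMap b a
  have hη : ∀ t ∈ Set.Icc (0 : ℝ) 1, η t ∈ ball (e p) R := by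
    intro t ht
    refine (convex_ball (e p) R).segment_subset hb ha ?_
    rw [segment_eq_image_lineMap]
    exact ⟨t, ht, rfl⟩
  have hη_smooth : ContMDiffOn 𝓘(ℝ, ℝ) 𝓘(ℝ, EuclideanSpace ℝ (Fin n)) 1 η (Set.Icc 0 1) :=
    η.contDiff.contMDiff.contMDiffOn
  have hq : 0 ≤ chartNorm n p (a - b) := norm_nonneg _
  have hpath : riemannianEDist (𝓡 n) (e.symm b) (e.symm a) ≤
      pathELength (𝓡 n) (e.symm ∘ η) 0 1 := by
    refine riemannianEDist_le_pathELength ?_ ?_ ?_ zero_le_one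
    · exact (contMDiffOn_extChartAt_symm p).comp hη_smooth fun t ht ↦ (hsub (hη t ht)).1
    · simp [η, ContinuousAffineMap.coe_lineMap_eq]
    · simp [η, ContinuousAffineMap.coe_lineMap_eq]
  have hlen : pathELength (𝓡 n) (e.symm ∘ η) 0 1 ≤ ENNReal.ofReal (2 * chartNorm n p (a - b)) := by
    rw [pathELength_eq_lintegral_mfderivWithin_Icc]
    calc _ ≤ ∫⁻ _ in Set.Icc (0 : ℝ) 1, ENNReal.ofReal (2 * chartNorm n p (a - b)) := by
          refine setLIntegral_mono' measurableSet_Icc fun t ht ↦ ?_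
          have h1 : mfderivWithin 𝓘(ℝ, ℝ) (𝓡 n) (e.symm ∘ η) (Set.Icc 0 1) t =
              (mfderivWithin 𝓘(ℝ, EuclideanSpace ℝ (Fin n)) (𝓡 n) e.symm (Set.range (𝓡 n)) (η t))
                ∘L (mfderivWithin 𝓘(ℝ, ℝ) 𝓘(ℝ, EuclideanSpace ℝ (Fin n)) η (Set.Icc 0 1) t) := by
            apply mfderivWithin_comp
            · exact mdifferentiableWithinAt_extChartAt_symm (hsub (hη t ht)).1
            · exact hη_smooth.mdifferentiableOn one_ne_zero t ht
            · intro s hs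
              exact extChartAt_target_subset_range p (hsub (hη s hs)).1
            · rw [uniqueMDiffWithinAt_iff_uniqueDiffWithinAt]
              exact uniqueDiffOn_Icc zero_lt_one t ht
          have h2 : mfderivWithin 𝓘(ℝ, ℝ) 𝓘(ℝ, EuclideanSpace ℝ (Fin n)) η (Set.Icc 0 1) t
              (1 : ℝ) = a - b := by
            rw [mfderivWithin_eq_fderivWithin,
              fderivWithin_eq_fderiv (uniqueDiffOn_Icc zero_lt_one t ht)
                η.contDiff.contDiffAt.differentiableAt_one]
            change fderiv ℝ (ContinuousAffineMap.lineMap (R := ℝ) b a) t 1 = a - b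
            simp
          have h3 : mfderivWithin 𝓘(ℝ, ℝ) (𝓡 n) (e.symm ∘ η) (Set.Icc 0 1) t (1 : ℝ) =
              mfderivWithin 𝓘(ℝ, EuclideanSpace ℝ (Fin n)) (𝓡 n) e.symm (Set.range (𝓡 n)) (η t)
                (a - b) := by
            rw [h1, ← h2]
            rfl
          rw [← ofReal_norm]
          refine ENNReal.ofReal_le_ofReal ?_
          have h4 := (hsub (hη t ht)).2 (a - b)
          rw [← h3] at h4
          exact h4
      _ = _ := by simp
  have := (IsRiemannianManifold.out (I := 𝓡 n) (e.symm b) (e.symm a)).trans_le (hpath.trans hlen)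
  rwa [edist_dist, ENNReal.ofReal_le_ofReal_iff (by positivity)] at this

omit [RiemannianBundle (fun x : M ↦ TangentSpace (𝓡 n) x)]
  [IsContinuousRiemannianBundle (EuclideanSpace ℝ (Fin n))
    (fun x : M ↦ TangentSpace (𝓡 n) x)] in
theorem hasMFDerivAt_comp_extChartAt {p y : M}
    (hy : y ∈ (chartAt (EuclideanSpace ℝ (Fin n)) p).source) {G : EuclideanSpace ℝ (Fin n) → ℝ}
    (hG : DifferentiableAt ℝ G (extChartAt (𝓡 n) p y)) :
    HasMFDerivAt (𝓡 n) 𝓘(ℝ, ℝ) (G ∘ extChartAt (𝓡 n) p) y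
      ((fderiv ℝ G (extChartAt (𝓡 n) p y)).comp
        (mfderiv (𝓡 n) 𝓘(ℝ, EuclideanSpace ℝ (Fin n)) (extChartAt (𝓡 n) p) y)) :=
  HasMFDerivAt.comp y hG.hasFDerivAt.hasMFDerivAt (mdifferentiableAt_extChartAt hy).hasMFDerivAt

/-- Near any point, Lipschitz functions are approximated by smooth functions with differential
bounded by 4 times the Lipschitz constant. -/
theorem exists_isOpen_forall_exists_approx [IsManifold (𝓡 n) ∞ M] [IsRiemannianManifold (𝓡 n) M]
    (p : M) :
    ∃ U : Set M, IsOpen U ∧ p ∈ U ∧ ∀ (f : M → ℝ) (L ε : ℝ), 0 ≤ L → 0 < ε →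
      (∀ x y, |f x - f y| ≤ L * dist x y) →
      ∃ g : M → ℝ, ContMDiffOn (𝓡 n) 𝓘(ℝ, ℝ) ∞ g U ∧
        ∀ y ∈ U, |g y - f y| ≤ ε ∧ MDerivBoundAt n g (4 * L) y := by
  obtain ⟨R, hR, hRt, hdist⟩ := exists_dist_extChartAt_symm_le (n := n) p
  obtain ⟨C, hC, hqC⟩ := exists_chartNorm_le (n := n) p
  set e := extChartAt (𝓡 n) p with he
  have hU : ∀ᶠ y in 𝓝 p, y ∈ (chartAt (EuclideanSpace ℝ (Fin n)) p).source ∧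
      e y ∈ ball (e p) (R / 2) ∧ ∀ w : TangentSpace (𝓡 n) y,
      chartNorm n p (mfderiv (𝓡 n) 𝓘(ℝ, EuclideanSpace ℝ (Fin n)) e y w) ≤ 2 * ‖w‖ :=
    Filter.Eventually.and (chart_source_mem_nhds (EuclideanSpace ℝ (Fin n)) p)
      (((continuousAt_extChartAt p).eventually_mem (ball_mem_nhds _ (by positivity))).and
        (eventually_chartNorm_mfderiv_le p))
  obtain ⟨U, hUsub, hUo, hpU⟩ := _root_.eventually_nhds_iff.1 hU
  refine ⟨U, hUo, hpU, fun f L ε hL hε hf ↦ ?_⟩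
  -- The 2 in `q` is the Lipschitz factor of the inverse chart; the chart differential contributes
  -- another 2, whence `4 * L`.
  obtain ⟨G, hG, hGb⟩ := exists_contDiff_approx_of_abs_sub_le (h := f ∘ e.symm)
    (q := fun v ↦ 2 * L * chartNorm n p v) (a := e p) (C := 2 * L * C) hR hε (by positivity)
    (fun v ↦ by
      rw [mul_assoc (2 * L)]
      exact mul_le_mul_of_nonneg_left (hqC v) (by positivity))
    (fun t v ↦ by rw [chartNorm_smul]; ring)
    (fun v ↦ mul_nonneg (by positivity) (norm_nonneg _))
    (fun x hx y hy ↦ by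
      refine (hf _ _).trans ?_
      rw [mul_comm 2 L, mul_assoc]
      exact mul_le_mul_of_nonneg_left (hdist x hx y hy) hL)
  refine ⟨G ∘ e, ?_, fun y hy ↦ ?_⟩
  · exact hG.contMDiff.comp_contMDiffOn ((contMDiffOn_extChartAt (I := 𝓡 n) (x := p)).mono
      fun y hy ↦ (hUsub y hy).1)
  · obtain ⟨hys, hyR, hyq⟩ := hUsub y hy
    obtain ⟨h1, h2⟩ := hGb (e y) hyR
    refine ⟨?_, _, hasMFDerivAt_comp_extChartAt hys (hG.differentiable (by simp) _), fun w ↦ ?_⟩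
    · rwa [Function.comp_apply, e.left_inv (by rwa [extChartAt_source])] at h1
    · refine (h2 _).trans ?_
      calc 2 * L * chartNorm n p _ ≤ 2 * L * (2 * ‖w‖) :=
            mul_le_mul_of_nonneg_left (hyq w) (by positivity)
        _ = 4 * L * ‖w‖ := by ring

/-- The differential of a `C^1` function is locally bounded. -/
theorem exists_eventually_mderivBoundAt {f : M → ℝ} (hf : ContMDiff (𝓡 n) 𝓘(ℝ, ℝ) 1 f) (p : M) :
    ∃ C, 0 ≤ C ∧ ∀ᶠ y in 𝓝 p, MDerivBoundAt n f C y := by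
  set e := extChartAt (𝓡 n) p with he
  obtain ⟨C, hC, hCb⟩ := eventually_norm_trivializationAt_lt (EuclideanSpace ℝ (Fin n))
    (fun x : M ↦ TangentSpace (𝓡 n) x) p
  have hG : ContDiffOn ℝ 1 (f ∘ e.symm) e.target := by
    rw [← contMDiffOn_iff_contDiffOn]
    exact hf.comp_contMDiffOn (contMDiffOn_extChartAt_symm p)
  have hto : IsOpen e.target := isOpen_extChartAt_target p
  have hfc : ContinuousAt (fun z ↦ ‖fderiv ℝ (f ∘ e.symm) z‖) (e p) :=
    ((hG.continuousOn_fderiv_of_isOpen hto le_rfl).norm).continuousAt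
      (hto.mem_nhds (mem_extChartAt_target p))
  obtain ⟨K, hK⟩ := exists_gt ‖fderiv ℝ (f ∘ e.symm) (e p)‖
  have hK0 : 0 ≤ K := (norm_nonneg _).trans hK.le
  have hev : ∀ᶠ y in 𝓝 p, ‖fderiv ℝ (f ∘ e.symm) (e y)‖ < K :=
    (continuousAt_extChartAt p).eventually (hfc.eventually_lt_const hK)
  refine ⟨K * C, by positivity, ?_⟩
  filter_upwards [hev, hCb, chart_source_mem_nhds (EuclideanSpace ℝ (Fin n)) p] with y hyK hyC hys
  have hys' : y ∈ e.source := by rwa [extChartAt_source]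
  have hd : DifferentiableAt ℝ (f ∘ e.symm) (e y) :=
    (hG.contDiffAt (hto.mem_nhds (e.map_source hys'))).differentiableAt one_ne_zero
  have hb : MDerivBoundAt n ((f ∘ e.symm) ∘ e) (K * C) y := by
    refine ⟨_, hasMFDerivAt_comp_extChartAt hys hd, fun w ↦ ?_⟩
    rw [← TangentBundle.continuousLinearMapAt_trivializationAt hys]
    have h1 := ContinuousLinearMap.le_of_opNorm_le _ hyC.le w
    refine (ContinuousLinearMap.le_of_opNorm_le _ hyK.le _).trans ?_
    rw [mul_assoc]
    exact mul_le_mul_of_nonneg_left h1 hK0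
  refine hb.congr_of_eventuallyEq ?_
  filter_upwards [(isOpen_extChartAt_source (I := 𝓡 n) p).mem_nhds hys'] with z hz
  rw [Function.comp_apply, Function.comp_apply, e.left_inv hz]

/-- The differential of a `C^1` function is bounded on compact sets. -/
theorem IsCompact.exists_mderivBoundAt {K : Set M} (hK : IsCompact K) {f : M → ℝ}
    (hf : ContMDiff (𝓡 n) 𝓘(ℝ, ℝ) 1 f) : ∃ C, 0 ≤ C ∧ ∀ x ∈ K, MDerivBoundAt n f C x := by
  refine hK.induction_on (p := fun s ↦ ∃ C, 0 ≤ C ∧ ∀ x ∈ s, MDerivBoundAt n f C x)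
    ⟨0, le_rfl, fun x hx ↦ hx.elim⟩ ?_ ?_ ?_
  · rintro s t hst ⟨C, hC, h⟩
    exact ⟨C, hC, fun x hx ↦ h x (hst hx)⟩
  · rintro s t ⟨C, hC, h⟩ ⟨C', hC', h'⟩
    refine ⟨max C C', hC.trans (le_max_left _ _), ?_⟩
    rintro x (hx | hx)
    · exact (h x hx).mono (le_max_left _ _)
    · exact (h' x hx).mono (le_max_right _ _)
  · intro x _
    obtain ⟨C, hC, h⟩ := exists_eventually_mderivBoundAt hf x
    exact ⟨_, nhdsWithin_le_nhds h, C, hC, fun y hy ↦ hy⟩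

end LocalSmoothing

/-! ### Properness and global smoothing -/

section Global

open Metric

variable {n : ℕ} {M : Type*} [MetricSpace M] [ChartedSpace (EuclideanSpace ℝ (Fin n)) M]
  [RiemannianBundle (fun x : M ↦ TangentSpace (𝓡 n) x)]

/-- In a Riemannian manifold, the distance between two points is approximately attained through
points at any prescribed intermediate distance. -/
theorem IsRiemannianManifold.exists_dist_eq_dist_lt [IsManifold (𝓡 n) 1 M]
    [IsRiemannianManifold (𝓡 n) M] (x y : M) {s ε : ℝ} (hs : 0 ≤ s) (hsd : s ≤ dist x y)
    (hε : 0 < ε) : ∃ z, dist x z = s ∧ dist z y < dist x y - s + ε := by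
  have hlt : riemannianEDist (𝓡 n) x y < ENNReal.ofReal (dist x y + ε) := by
    rw [← IsRiemannianManifold.out (I := 𝓡 n) x y, edist_dist]
    exact (ENNReal.ofReal_lt_ofReal_iff (by positivity)).2 (by linarith)
  obtain ⟨γ, h0, h1, hγ, hlen, -⟩ :=
    exists_lt_locally_constant_of_riemannianEDist_lt hlt zero_lt_one
  -- Along a nearly shortest curve the distance to `x` takes the value `s`; the two subarcs at that
  -- point bound both distances.
  have hc : ContinuousOn (fun t ↦ dist x (γ t)) (Set.Icc 0 1) :=
    (continuous_const.dist hγ.continuous).continuousOn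
  obtain ⟨t, ht, hts⟩ := intermediate_value_Icc zero_le_one hc
    (show s ∈ Set.Icc (dist x (γ 0)) (dist x (γ 1)) by simpa [h0, h1] using ⟨hs, hsd⟩)
  refine ⟨γ t, hts, ?_⟩
  have hx := riemannianEDist_le_pathELength (hγ.contMDiffOn (s := Set.Icc 0 t)) h0 rfl ht.1
  have hy := riemannianEDist_le_pathELength (hγ.contMDiffOn (s := Set.Icc t 1)) rfl h1 ht.2
  have hsum := add_le_add hx hy
  rw [pathELength_add ht.1 ht.2, ← IsRiemannianManifold.out (I := 𝓡 n),
    ← IsRiemannianManifold.out (I := 𝓡 n), edist_dist, edist_dist,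
    ← ENNReal.ofReal_add dist_nonneg dist_nonneg] at hsum
  have := (ENNReal.ofReal_lt_ofReal_iff (by positivity)).1 (hsum.trans_lt hlen)
  have hts' : dist x (γ t) = s := hts
  linarith

variable (M) in
/-- Closed balls of a complete Riemannian manifold are compact. -/
theorem IsRiemannianManifold.properSpace (n : ℕ) [ChartedSpace (EuclideanSpace ℝ (Fin n)) M]
    [RiemannianBundle (fun x : M ↦ TangentSpace (𝓡 n) x)] [IsManifold (𝓡 n) 1 M]
    [IsRiemannianManifold (𝓡 n) M] [CompleteSpace M] : ProperSpace M := by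
  have : LocallyCompactSpace M := ChartedSpace.locallyCompactSpace (EuclideanSpace ℝ (Fin n)) M
  refine properSpace_of_exists_dist_le fun x y s ε hs hsd hε ↦ ?_
  obtain ⟨z, hz, hzy⟩ := exists_dist_eq_dist_lt (n := n) x y hs hsd hε
  exact ⟨z, hz.le, hzy.le⟩

/-- A compactly supported Lipschitz function is uniformly approximated by smooth functions whose
differential is bounded by 5 times the Lipschitz constant. -/
theorem exists_contMDiff_approx_of_hasCompactSupport [IsManifold (𝓡 n) ∞ M]
    [IsContinuousRiemannianBundle (EuclideanSpace ℝ (Fin n)) (fun x : M ↦ TangentSpace (𝓡 n) x)]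
    [IsRiemannianManifold (𝓡 n) M] [SigmaCompactSpace M] {f : M → ℝ} {L ε : ℝ}
    (hL : 0 < L) (hε : 0 < ε) (hf : ∀ x y, |f x - f y| ≤ L * dist x y)
    (hfs : HasCompactSupport f) :
    ∃ g : M → ℝ, ContMDiff (𝓡 n) 𝓘(ℝ, ℝ) ∞ g ∧
      ∀ x, |g x - f x| ≤ ε ∧ MDerivBoundAt n g (5 * L) x := by
  classical
  have : LocallyCompactSpace M := ChartedSpace.locallyCompactSpace (EuclideanSpace ℝ (Fin n)) M
  -- a relatively compact cover by open sets on which `f` can be smoothed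
  have hV : ∀ p : M, ∃ V : Set M, IsOpen V ∧ p ∈ V ∧ IsCompact (closure V) ∧ ∀ δ > 0,
      ∃ g : M → ℝ, ContMDiffOn (𝓡 n) 𝓘(ℝ, ℝ) ∞ g V ∧
        ∀ y ∈ V, |g y - f y| ≤ δ ∧ MDerivBoundAt n g (4 * L) y := by
    intro p
    obtain ⟨U, hUo, hpU, hU⟩ := exists_isOpen_forall_exists_approx (n := n) p
    obtain ⟨K, hK, hpK⟩ := exists_compact_mem_nhds p
    refine ⟨U ∩ interior K, hUo.inter isOpen_interior, ⟨hpU, mem_interior_iff_mem_nhds.2 hpK⟩,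
      hK.of_isClosed_subset isClosed_closure
        (closure_minimal (Set.inter_subset_right.trans interior_subset) hK.isClosed),
      fun δ hδ ↦ ?_⟩
    obtain ⟨g, hg, hgb⟩ := hU f L δ hL.le hδ hf
    exact ⟨g, hg.mono Set.inter_subset_left, fun y hy ↦ hgb y hy.1⟩
  choose V hVo hpV hVc hVg using hV
  obtain ⟨ρ, hρ⟩ := SmoothPartitionOfUnity.exists_isSubordinate (𝓡 n) isClosed_univ V hVo
    fun x _ ↦ Set.mem_iUnion.2 ⟨x, hpV x⟩
  -- These finitely many weights suffice: they sum to 1 wherever `f` lives, and elsewhere the target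
  -- value is 0.
  have hfin : {i | (Function.support (ρ i) ∩ tsupport f).Nonempty}.Finite :=
    ρ.locallyFinite.finite_nonempty_inter_compact hfs
  set t := hfin.toFinset
  have hsum : ∀ x ∈ tsupport f, ∑ i ∈ t, ρ i x = 1 := by
    intro x hx
    refine ρ.sum_finsupport' x (Set.mem_univ x) fun i hi ↦ ?_
    rw [ρ.mem_finsupport] at hi
    exact hfin.mem_toFinset.2 ⟨x, hi, hx⟩
  have hsum_le : ∀ x, ∑ i ∈ t, ρ i x ≤ 1 := by
    intro x
    rw [← ρ.sum_finsupport' x (Set.mem_univ x) (Finset.subset_union_left (s₂ := t))]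
    exact Finset.sum_le_sum_of_subset_of_nonneg Finset.subset_union_right
      fun i _ _ ↦ ρ.nonneg i x
  have hρC : ∀ i, ∃ C, 0 ≤ C ∧ ∀ x, MDerivBoundAt n (ρ i) C x := by
    intro i
    have hc : IsCompact (tsupport (ρ i)) :=
      (hVc i).of_isClosed_subset (isClosed_tsupport _) ((hρ i).trans subset_closure)
    obtain ⟨C, hC, h⟩ := hc.exists_mderivBoundAt ((ρ i).contMDiff.of_le (by simp))
    refine ⟨C, hC, fun x ↦ ?_⟩
    by_cases hx : x ∈ tsupport (ρ i)
    · exact h x hx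
    · exact ((MDerivBoundAt.const 0).mono hC).congr_of_eventuallyEq
        (notMem_tsupport_iff_eventuallyEq.1 hx)
  choose C hC hCb using hρC
  set S := ∑ i ∈ t, C i
  have hS : 0 ≤ S := Finset.sum_nonneg fun i _ ↦ hC i
  -- The local accuracy is fixed after the partition, which is possible because the cover `V` does
  -- not depend on it. The gluing error `δ * S` is the fifth `L`.
  obtain ⟨δ, hδ, hδε, hδS⟩ : ∃ δ > 0, δ ≤ ε ∧ δ * S ≤ L := by
    refine ⟨min ε (L / (S + 1)), by positivity, min_le_left _ _, ?_⟩
    calc min ε (L / (S + 1)) * S ≤ (L / (S + 1)) * (S + 1) := by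
          gcongr
          · exact min_le_right _ _
          · linarith
      _ = L := by field_simp
  choose g hg hgb using fun p ↦ hVg p δ hδ
  refine ⟨fun x ↦ ∑ i ∈ t, ρ i x * g i x, ?_, fun x ↦ ⟨?_, ?_⟩⟩
  · refine contMDiff_finsetSum fun i _ ↦ ?_
    exact ρ.contMDiff_smul fun x hx ↦ (hg i).contMDiffAt ((hVo i).mem_nhds (hρ i hx))
  · have hterm : ∀ i ∈ t, |ρ i x * (g i x - f x)| ≤ ρ i x * δ := by
      intro i _
      rw [abs_mul, abs_of_nonneg (ρ.nonneg i x)]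
      by_cases hx : x ∈ tsupport (ρ i)
      · exact mul_le_mul_of_nonneg_left (hgb i x (hρ i hx)).1 (ρ.nonneg i x)
      · simp [image_eq_zero_of_notMem_tsupport hx]
    have hfx : (∑ i ∈ t, ρ i x) * f x = f x := by
      by_cases hx : x ∈ tsupport f
      · rw [hsum x hx, one_mul]
      · rw [image_eq_zero_of_notMem_tsupport hx, mul_zero]
    calc |∑ i ∈ t, ρ i x * g i x - f x| = |∑ i ∈ t, ρ i x * (g i x - f x)| := by
          simp only [mul_sub, Finset.sum_sub_distrib, ← Finset.sum_mul, hfx]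
      _ ≤ ∑ i ∈ t, |ρ i x * (g i x - f x)| := Finset.abs_sum_le_sum_abs _ _
      _ ≤ ∑ i ∈ t, ρ i x * δ := Finset.sum_le_sum hterm
      _ = (∑ i ∈ t, ρ i x) * δ := by rw [Finset.sum_mul]
      _ ≤ 1 * δ := mul_le_mul_of_nonneg_right (hsum_le x) hδ.le
      _ ≤ ε := by linarith
  -- Subtracting the constant `f x` makes the derivative of `ρ i` multiply an error of size at most
  -- `δ`.
  · have hterm : ∀ i ∈ t, MDerivBoundAt n (fun y ↦ ρ i y * (g i y + -f x))
        (ρ i x * (4 * L) + δ * C i) x := by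
      intro i _
      by_cases hx : x ∈ tsupport (ρ i)
      · obtain ⟨h1, h2⟩ := hgb i x (hρ i hx)
        refine ((hCb i x).mul (h2.add (MDerivBoundAt.const (-f x)))).mono ?_
        rw [abs_of_nonneg (ρ.nonneg i x), add_zero, ← sub_eq_add_neg]
        gcongr
        exact hC i
      · refine ((MDerivBoundAt.const 0).congr_of_eventuallyEq (g := fun y ↦ ρ i y * (g i y + -f x))
          ?_).mono (C' := ρ i x * (4 * L) + δ * C i) ?_
        · filter_upwards [notMem_tsupport_iff_eventuallyEq.1 hx] with y hy
          simp [hy]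
        · have := ρ.nonneg i x
          have := hC i
          positivity
    -- If `f x ≠ 0`, then `f` is nonzero near `x`, so the weights sum to 1 there.
    have hconst : MDerivBoundAt n (fun y ↦ f x * ∑ i ∈ t, ρ i y) 0 x := by
      by_cases hx : f x = 0
      · simpa [hx] using MDerivBoundAt.const (n := n) (x := x) 0
      · have hfc : Continuous f := by
          refine (LipschitzWith.of_dist_le_mul (K := ⟨L, hL.le⟩) fun x y ↦ ?_).continuous
          rw [Real.dist_eq]
          exact hf x y
        refine (MDerivBoundAt.const (f x)).congr_of_eventuallyEq ?_
        filter_upwards [hfc.continuousAt.eventually_ne hx] with y hy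
        rw [hsum y (subset_tsupport f hy), mul_one]
    refine ((MDerivBoundAt.sum hterm).add hconst).mono ?_ |>.congr_of_eventuallyEq
      (Eventually.of_forall fun y ↦ ?_)
    · rw [add_zero, Finset.sum_add_distrib, ← Finset.sum_mul, ← Finset.mul_sum]
      have := mul_le_mul_of_nonneg_right (hsum_le x) (by positivity : 0 ≤ 4 * L)
      linarith
    · simp only [mul_add, Finset.sum_add_distrib, ← Finset.sum_mul]
      ring

end Global

/-- Existence of smooth compactly supported cut-off functions with uniformly small gradients on a
connected complete Riemannian manifold. -/
theorem proposition4p1 {n : ℕ} {M : Type*} [MetricSpace M]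
    [ChartedSpace (EuclideanSpace ℝ (Fin n)) M] [IsManifold (𝓡 n) ∞ M]
    [RiemannianBundle (fun x : M ↦ TangentSpace (𝓡 n) x)]
    [IsContMDiffRiemannianBundle (𝓡 n) ∞ (EuclideanSpace ℝ (Fin n))
      (fun x : M ↦ TangentSpace (𝓡 n) x)]
    [IsRiemannianManifold (𝓡 n) M] [ConnectedSpace M] [CompleteSpace M] :
    ∃ φ : ℕ → M → ℝ,
      (∀ N, ContMDiff (𝓡 n) 𝓘(ℝ, ℝ) ∞ (φ N) ∧ HasCompactSupport (φ N)) ∧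
      (∀ N x, 0 ≤ φ N x ∧ φ N x ≤ 1) ∧
      (∀ K : Set M, IsCompact K → ∃ N₀ : ℕ, 0 < N₀ ∧ ∀ N, N₀ ≤ N → ∀ x ∈ K, φ N x = 1) ∧
      (∀ N, BddAbove (Set.range fun x ↦ ‖riemannianGradient n (φ N) x‖)) ∧
      Tendsto (fun N ↦ ⨆ x : M, ‖riemannianGradient n (φ N) x‖) atTop (𝓝 0) := by
  have : ProperSpace M := IsRiemannianManifold.properSpace M n
  have : IsContinuousRiemannianBundle (EuclideanSpace ℝ (Fin n))
    (fun x : M ↦ TangentSpace (𝓡 n) x) := by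
    obtain ⟨G, hG, hGi⟩ := IsContMDiffRiemannianBundle.exists_contMDiff (IB := 𝓡 n) (n := ∞)
      (F := EuclideanSpace ℝ (Fin n)) (E := fun x : M ↦ TangentSpace (𝓡 n) x)
    exact ⟨G, hG.continuous, hGi⟩
  obtain ⟨o⟩ : Nonempty M := inferInstance
  -- `χ` is 0 up to `1 / 4` and 1 from `3 / 4` on, so it absorbs a smoothing error of `1 / 4` around
  -- the values 0 and 1.
  let χ : ℝ → ℝ := fun s ↦ Real.smoothTransition (2 * s - 1 / 2)
  have hχ : ContDiff ℝ ∞ χ := Real.smoothTransition.contDiff.comp (by fun_prop)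
  obtain ⟨B, hB0, hB⟩ := Real.smoothTransition.exists_abs_deriv_le
  have hχ' : ∀ s, |deriv χ s| ≤ 2 * B := by
    intro s
    have h1 : HasDerivAt (fun s : ℝ ↦ 2 * s - 1 / 2) 2 s := by
      simpa using ((hasDerivAt_id s).const_mul 2).sub_const (1 / 2)
    have h2 : HasDerivAt Real.smoothTransition (deriv Real.smoothTransition (2 * s - 1 / 2)) (2 * s - 1 / 2) :=
      ((Real.smoothTransition.contDiff (n := 1)).differentiable one_ne_zero _).hasDerivAt
    have h3 : deriv χ s = deriv Real.smoothTransition (2 * s - 1 / 2) * 2 :=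
      (HasDerivAt.comp (h := fun s : ℝ ↦ 2 * s - 1 / 2) s h2 h1).deriv
    rw [h3, abs_mul, abs_two, mul_comm]
    exact mul_le_mul_of_nonneg_left (hB _) zero_le_two
  let f : ℕ → M → ℝ := fun N x ↦ max 0 (min 1 (2 - dist x o / (N + 1)))
  have hf_far : ∀ (N : ℕ) x, 2 * ((N : ℝ) + 1) ≤ dist x o → f N x = 0 := by
    intro N x hx
    have : 2 ≤ dist x o / (N + 1) := by rwa [le_div_iff₀ (by positivity)]
    exact max_eq_left ((min_le_right _ _).trans (by linarith))
  have hf_near : ∀ (N : ℕ) x, dist x o ≤ (N : ℝ) + 1 → f N x = 1 := by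
    intro N x hx
    have : dist x o / (N + 1) ≤ 1 := by rwa [div_le_one (by positivity)]
    simp only [f]
    rw [min_eq_left (by linarith), max_eq_right zero_le_one]
  have hf_lip : ∀ (N : ℕ) x y, |f N x - f N y| ≤ 1 / ((N : ℝ) + 1) * dist x y := by
    intro N x y
    refine (abs_max_sub_max_le_max _ _ _ _).trans ?_
    rw [sub_self, abs_zero, max_eq_right (abs_nonneg _)]
    refine (abs_min_sub_min_le_max _ _ _ _).trans ?_
    rw [sub_self, abs_zero, max_eq_right (abs_nonneg _), sub_sub_sub_cancel_left, ← sub_div,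
      abs_div, abs_of_pos (by positivity : (0 : ℝ) < N + 1), div_mul_eq_mul_div, one_mul,
      dist_comm x y]
    gcongr
    exact abs_dist_sub_le y x o
  have hf_supp : ∀ N, HasCompactSupport (f N) := fun N ↦
    HasCompactSupport.intro (isCompact_closedBall o (2 * ((N : ℝ) + 1))) fun x hx ↦
      hf_far N x (not_le.1 hx).le
  choose g hg hgb using fun N : ℕ ↦ exists_contMDiff_approx_of_hasCompactSupport (n := n)
    (ε := 1 / 4) (by positivity) (by norm_num) (hf_lip N) (hf_supp N)
  have hgrad : ∀ (N : ℕ) x, ‖riemannianGradient n (fun y ↦ χ (g N y)) x‖ ≤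
      2 * B * (5 * (1 / ((N : ℝ) + 1))) := fun N x ↦
    (MDerivBoundAt.comp (hχ.differentiable (by simp) _) (hχ' _)
      (hgb N x).2).norm_riemannianGradient_le (by positivity)
  refine ⟨fun N x ↦ χ (g N x), fun N ↦ ⟨hχ.contMDiff.comp (hg N), ?_⟩,
    fun N x ↦ ⟨Real.smoothTransition.nonneg _, Real.smoothTransition.le_one _⟩, fun K hK ↦ ?_,
    fun N ↦ ⟨_, Set.forall_mem_range.2 (hgrad N)⟩, ?_⟩
  · refine HasCompactSupport.intro (isCompact_closedBall o (2 * ((N : ℝ) + 1))) fun x hx ↦ ?_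
    have h := (abs_le.1 (hgb N x).1).2
    rw [hf_far N x (not_le.1 hx).le] at h
    exact Real.smoothTransition.zero_of_nonpos (by linarith)
  · obtain ⟨R, hR⟩ := hK.isBounded.subset_closedBall o
    obtain ⟨N₀, hN₀⟩ := exists_nat_ge R
    refine ⟨N₀ + 1, Nat.succ_pos _, fun N hN x hx ↦ ?_⟩
    have hN' : (N₀ : ℝ) + 1 ≤ N := by exact_mod_cast hN
    have hxR : dist x o ≤ R := hR hx
    have h := (abs_le.1 (hgb N x).1).1
    rw [hf_near N x (by linarith)] at h
    exact Real.smoothTransition.one_of_one_le (by linarith)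
  · refine squeeze_zero (fun N ↦ Real.iSup_nonneg fun x ↦ norm_nonneg _)
      (fun N ↦ Real.iSup_le (hgrad N) (by positivity)) ?_
    simpa using (tendsto_one_div_add_atTop_nhds_zero_nat (𝕜 := ℝ)).const_mul 5 |>.const_mul (2 * B)
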